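/- \textbf{Setting.} Let $\mathcal H=\mathcal H_1\oplus\dots\oplus\mathcal H_m$ be a finite direct sum of real Hilbert spaces with norm $\|x\|^2=\sum_{i=1}^m\|x_i\|^2$. Let $M:\mathcal H\to\mathcal H$ be a bounded self-adjoint linear operator that is positive definite, in the sense that $\langle x,Mx\rangle\ge c\|x\|^2$ for all $x\in\mathcal H$ and some $c>0$, and put $\|x\|_M=\sqrt{\langle x,Mx\rangle}$. For $\theta\in(0,1]$, an operator $T:\mathcal H\to\mathcal H$ is called $\theta$-averaged with respect to $\|\cdot\|_M$ if $T=(1-\theta)I+\theta C$ for some $C:\mathcal H\to\mathcal H$ with $\|Cx-Cy\|_M\le\|x-y\|_M$ for all $x,y$ (for $\theta=1$: $T$ is non-expansive). The infimal displacement vector $\mathbf v$ of such a $T$ is the element of minimal $M$-norm in the closure of $\operatorname{range}(I-T)$; it exists and is unique. For $s\in\mathbb R^m$ and $u\in\mathcal H$ let $u_s=(s_1u_1,\dots,s_mu_m)$. Let $S=\theta^{-1}(I-T)$ and $T_sx=x-\theta\,(Sx)_s$. Let $\mathcal I^0,\mathcal I^1,\dots$ be i.i.d.\ random vectors whose common distribution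 is supported in $[0,1]^m$ and satisfies $\mathbb E[\mathcal I^0]=\alpha(1,\dots,1)$, where $\alpha\in(0,1]$. Let $x^0\in\mathcal H$ and $x^{k+1}=T_{\mathcal I^k}x^k$ for $k=0,1,2,\dots$. \textbf{Theorem.} \begin{enumerate} \item If $\theta\in(0,1)$ and $T$ is $\theta$-averaged with respect to the norm $\|\cdot\|$ of $\mathcal H$ (that is, $M=I$), then, with $\mathbf v$ the infimal displacement vector of $T$, almost surely \[\frac{x^k}{k}\to-\alpha\mathbf v\quad\text{strongly in }\mathcal H\text{ as }k\to\infty.\] \item More generally, let $M$ be as above, let $\theta\in(0,1]$, let $T$ be $\theta$-averaged with respect to $\|\cdot\|_M$, and suppose that for some real number $\beta<\alpha/\theta$ \[\mathbb E\big[\|u_{\mathcal I^0}\|_M^2\big]\le\beta\|u\|_M^2\qquad\text{for all }u\in\mathcal H.\] Then, with $\mathbf v$ the infimal displacement vector of $T$ with respect to $\|\cdot\|_M$, almost surely $x^k/k\to-\alpha\mathbf v$ strongly in $\mathcal H$ as $k\to\infty$. \end{enumerate} -/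

import Mathlib

open MeasureTheory ProbabilityTheory Filter Topology

namespace RCFPI

section MNorm

variable {H : Type*} [NormedAddCommGroup H] [InnerProductSpace ℝ H]

/-- `M` is a bounded, self-adjoint, positive definite operator on a real Hilbert space.
Positive definiteness is meant in the sense in which `⟪x, M y⟫` is again a Hilbert space inner
product on the same space, i.e. `⟪x, M x⟫` is bounded below by a positive multiple of `‖x‖ ^ 2`
(in finite dimension this is the same as `0 < ⟪x, M x⟫` for all `x ≠ 0`). -/
structure IsPosDef (M : H →L[ℝ] H) : Prop where
  symm : ∀ x y : H, inner ℝ (M x) y = inner ℝ x (M y)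
  pos : ∃ c : ℝ, 0 < c ∧ ∀ x : H, c * ‖x‖ ^ 2 ≤ inner ℝ x (M x)

/-- The `M`-norm `‖x‖_M = √⟪x, M x⟫`. -/
noncomputable def mNorm (M : H →L[ℝ] H) (x : H) : ℝ :=
  Real.sqrt (inner ℝ x (M x))

/-- For the identity operator, the `M`-norm is the norm of the space. -/
theorem mNorm_id (x : H) : mNorm (ContinuousLinearMap.id ℝ H) x = ‖x‖ := by
  simp [mNorm]

/-- `C` is non-expansive with respect to the `M`-norm. -/
def IsNonexpansive (M : H →L[ℝ] H) (C : H → H) : Prop :=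
  ∀ x y : H, mNorm M (C x - C y) ≤ mNorm M (x - y)

/-- `T = (1 - θ) I + θ C` for some operator `C` that is non-expansive in the `M`-norm.
For `θ = 1` this says that `T` itself is non-expansive. -/
def IsAveraged (M : H →L[ℝ] H) (θ : ℝ) (T : H → H) : Prop :=
  ∃ C : H → H, IsNonexpansive M C ∧ ∀ x : H, T x = (1 - θ) • x + θ • C x

/-- `v` is an element of minimal `M`-norm in the closure of the range of `I - T`. -/
def IsInfimalDisplacement (M : H →L[ℝ] H) (T : H → H) (v : H) : Prop :=
  v ∈ closure (Set.range fun x : H => x - T x) ∧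
    ∀ y ∈ closure (Set.range fun x : H => x - T x), mNorm M v ≤ mNorm M y

end MNorm

section Blocks

variable {m : ℕ} {E : Fin m → Type*} [∀ i, NormedAddCommGroup (E i)]
  [∀ i, InnerProductSpace ℝ (E i)]

/-- `u_s = ∑ i, s i • (0, …, 0, u i, 0, …, 0)`, that is, the `i`th block of `u` is multiplied
by `s i`. -/
def blockSelect (s : Fin m → ℝ) (u : PiLp 2 E) : PiLp 2 E :=
  WithLp.toLp 2 fun i => s i • u i

/-- `S = θ⁻¹ (I - T)`. -/
noncomputable def residual (T : PiLp 2 E → PiLp 2 E) (θ : ℝ) (x : PiLp 2 E) : PiLp 2 E :=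
  θ⁻¹ • (x - T x)

/-- `T_s = I - θ S_s`, where `S_s x` is the block selection of `S x` by `s`. -/
noncomputable def rcStep (T : PiLp 2 E → PiLp 2 E) (θ : ℝ) (s : Fin m → ℝ) (x : PiLp 2 E) :
    PiLp 2 E :=
  x - θ • blockSelect s (residual T θ x)

/-- The iterates `x (k + 1) = T_{s k} (x k)` started at `x0`, for a sequence `s` of selection
vectors. -/
noncomputable def rcIter (T : PiLp 2 E → PiLp 2 E) (θ : ℝ) (x0 : PiLp 2 E)
    (s : ℕ → Fin m → ℝ) : ℕ → PiLp 2 E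
  | 0 => x0
  | k + 1 => rcStep T θ (s k) (rcIter T θ x0 s k)

/-- `ν` is a distribution of selection vectors on `[0, 1] ^ m` that satisfies the uniform expected
step-size condition `𝔼 [s] = α (1, …, 1)`. -/
structure IsSelectionLaw (ν : Measure (Fin m → ℝ)) (α : ℝ) : Prop where
  mem_Icc : ∀ᵐ s ∂ν, ∀ i, s i ∈ Set.Icc (0 : ℝ) 1
  mean : ∀ i, ∫ s, s i ∂ν = α

/-- `𝔼 ‖u_s‖_M ^ 2 ≤ β ‖u‖_M ^ 2` for all `u`, where `s` has distribution `ν`. -/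
def SecondMomentBound (ν : Measure (Fin m → ℝ)) (M : PiLp 2 E →L[ℝ] PiLp 2 E) (β : ℝ) : Prop :=
  ∀ u : PiLp 2 E, ∫ s, mNorm M (blockSelect s u) ^ 2 ∂ν ≤ β * mNorm M u ^ 2

end Blocks

end RCFPI

/-!
Put `A = I - T`, so that the random iteration reads `x (k + 1) = x k - (A (x k))_{I k}`. After
passing to a Hilbert space `G` whose norm is the `M`-norm (`exists_equiv_norm_eq_mNorm`), the
averagedness of `T` says that `l * ‖A x - A y‖ ^ 2 ≤ 2 * ⟪x - y, A x - A y⟫` with `l = 1 / θ`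
(`IsCocoercive`).

The closure of the range of `A` is convex (`IsCocoercive.convex_closure_range`): for `y` in the
convex hull of the range, the solutions of `ε • x + A x = y` satisfy `ε • x → 0` as `ε → 0`. Hence
the closure has a unique element `v` of minimal norm.

The random iterates are compared with the deterministic ones, `y (k + 1) = y k - α • A (y k)`, for
which Pazy's theorem gives `y k / k → -α • v` (`IsCocoercive.tendsto_inv_smul_iterate_step`).
Given the past, `‖x (k + 1) - y (k + 1)‖ ^ 2` has mean at most `‖x k - y k‖ ^ 2 + C`, where `C`
does not depend on `k` (`integral_sq_norm_step_sub_le`): the condition `β < α / θ` makes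
cocoercivity dominate the variance caused by `A (x k) - A (y k)`, and what is left is controlled by
`‖A (y k)‖ ≤ ‖A (y 0)‖`. A supermartingale argument (`ae_tendsto_div_sq_of_condExp_le`) then shows
that almost surely `‖x k - y k‖ ^ 2 / k ^ 2 → 0`, so that `x k / k` and `y k / k` have the same
limit.

For the norm of the space itself the second moment condition holds with `β = α`
(`secondMomentBound_id`), and `α < α / θ` because `θ < 1`.
-/

/-! ### Cocoercive operators and infimal displacement vectors -/

section Cocoercive

variable {G : Type*} [NormedAddCommGroup G] [InnerProductSpace ℝ G]

/-- `A` is `l / 2`-cocoercive. For `θ ∈ (0, 1]`, the displacement `I - T` of a `θ`-averaged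
operator `T` has this property with `l = 1 / θ`. -/
def IsCocoercive (l : ℝ) (A : G → G) : Prop :=
  ∀ x y : G, l * ‖A x - A y‖ ^ 2 ≤ 2 * inner ℝ (x - y) (A x - A y)

namespace IsCocoercive

variable {l : ℝ} {A : G → G}

theorem norm_sub_le (hA : IsCocoercive l A) (hl : 0 < l) (x y : G) :
    ‖A x - A y‖ ≤ 2 / l * ‖x - y‖ := by
  have h := hA x y
  have h' := real_inner_le_norm (x - y) (A x - A y)
  rw [div_mul_eq_mul_div, le_div_iff₀ hl]
  by_cases h0 : ‖A x - A y‖ = 0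
  · rw [h0, zero_mul]; positivity
  · have : 0 < ‖A x - A y‖ := lt_of_le_of_ne (norm_nonneg _) (Ne.symm h0)
    by_contra! hc
    nlinarith

theorem continuous (hA : IsCocoercive l A) (hl : 0 < l) : Continuous A := by
  refine (LipschitzWith.of_dist_le_mul (K := (2 / l).toNNReal) fun x y => ?_).continuous
  rw [dist_eq_norm, dist_eq_norm, Real.coe_toNNReal _ (by positivity)]
  exact hA.norm_sub_le hl x y

/-- An explicit step `x ↦ x - a • A x` of length `a ≤ l` is non-expansive. -/
theorem norm_step_sub_le (hA : IsCocoercive l A) {a : ℝ} (ha : 0 ≤ a) (hal : a ≤ l) (x y : G) :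
    ‖(x - a • A x) - (y - a • A y)‖ ≤ ‖x - y‖ := by
  have e : (x - a • A x) - (y - a • A y) = (x - y) - a • (A x - A y) := by
    rw [smul_sub]; abel
  have h := hA x y
  have h2 : ‖(x - y) - a • (A x - A y)‖ ^ 2 ≤ ‖x - y‖ ^ 2 := by
    rw [norm_sub_sq_real, norm_smul, inner_smul_right, mul_pow, Real.norm_eq_abs, sq_abs]
    nlinarith [mul_le_mul_of_nonneg_left h ha,
      mul_nonneg (mul_nonneg ha (sub_nonneg.2 hal)) (sq_nonneg ‖A x - A y‖)]
  rw [e]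
  exact le_of_sq_le_sq h2 (norm_nonneg _)

/-- The resolvent equation of `A` is solvable, by the contraction principle. -/
theorem exists_smul_add_eq [CompleteSpace G] (hA : IsCocoercive l A) (hl : 0 < l)
    {ε : ℝ} (hε : 0 < ε) (y : G) : ∃ x, ε • x + A x = y := by
  have hq : 0 < l * ε + 1 := by positivity
  have hc : ContractingWith (l * ε + 1)⁻¹.toNNReal
      fun x => (l * ε + 1)⁻¹ • (x - l • A x + l • y) := by
    refine ⟨?_, LipschitzWith.of_dist_le_mul fun x z => ?_⟩
    · rw [Real.toNNReal_lt_one]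
      exact inv_lt_one_of_one_lt₀ (by linarith [mul_pos hl hε])
    · rw [dist_eq_norm, dist_eq_norm, Real.coe_toNNReal _ (by positivity), ← smul_sub,
        add_sub_add_right_eq_sub, norm_smul, Real.norm_of_nonneg (by positivity)]
      exact mul_le_mul_of_nonneg_left (hA.norm_step_sub_le hl.le le_rfl x z) (by positivity)
  have hfix := hc.fixedPoint_isFixedPt
  set x := ContractingWith.fixedPoint _ hc
  refine ⟨x, ?_⟩
  have h1 : x - l • A x + l • y = (l * ε + 1) • x := by
    rw [eq_comm, ← eq_inv_smul_iff₀ hq.ne']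
    exact hfix.symm
  have h2 : l • (ε • x + A x) = l • y := by
    rw [add_smul, mul_smul, one_smul] at h1
    rw [smul_add]
    rw [← sub_eq_zero] at h1 ⊢
    rw [← neg_eq_zero, ← h1]
    abel
  exact smul_right_injective G hl.ne' h2

/-- Convex combinations of values of `A` are limits of values of `A`: the solutions of
`ε • x + A x = a • A p + b • A q` satisfy `ε * ‖x‖ ^ 2 = O(1)` by monotonicity, so `ε • x → 0` as
`ε → 0`. -/
theorem combination_mem_closure_range [CompleteSpace G] (hA : IsCocoercive l A) (hl : 0 < l)
    (p q : G) {a b : ℝ} (ha : 0 ≤ a) (hb : 0 ≤ b) (hab : a + b = 1) :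
    a • A p + b • A q ∈ closure (Set.range A) := by
  set y := a • A p + b • A q with hy
  set w := a • p + b • q with hw
  set K := a * inner ℝ p (A p) + b * inner ℝ q (A q) - inner ℝ w y with hK
  set R := 2 * |K| + ‖w‖ ^ 2 with hR
  have hR0 : 0 ≤ R := by positivity
  have mono : ∀ x z, 0 ≤ inner ℝ (x - z) (A x - A z) := fun x z => by
    have := hA x z
    have : 0 ≤ l * ‖A x - A z‖ ^ 2 := by positivity
    linarith
  rw [Metric.mem_closure_iff]
  intro δ hδ
  -- for `ε ≤ 1` one gets `ε * ‖x‖ ^ 2 ≤ R`, and then `‖ε • x‖ ^ 2 ≤ ε * R < δ ^ 2`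
  set ε := min 1 (δ ^ 2 / (R + 1))
  have hε : 0 < ε := by positivity
  have hε1 : ε ≤ 1 := min_le_left _ _
  have hε2 : ε * (R + 1) ≤ δ ^ 2 := by
    rw [← le_div_iff₀ (by positivity)]; exact min_le_right _ _
  obtain ⟨x, hx⟩ := hA.exists_smul_add_eq hl hε y
  have hAx : A x = y - ε • x := by rw [← hx]; abel
  refine ⟨A x, ⟨x, rfl⟩, ?_⟩
  have key : a * inner ℝ (x - p) (A x - A p) + b * inner ℝ (x - q) (A x - A q)
      = K + ε * inner ℝ w x - ε * ‖x‖ ^ 2 := by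
    obtain rfl : b = 1 - a := by linarith
    rw [hK, hAx, hy, hw, ← real_inner_self_eq_norm_sq]
    simp only [inner_sub_left, inner_sub_right, inner_add_left, inner_add_right,
      inner_smul_left, inner_smul_right, conj_trivial]
    ring
  have h0 : 0 ≤ K + ε * inner ℝ w x - ε * ‖x‖ ^ 2 := by
    rw [← key]
    exact add_nonneg (mul_nonneg ha (mono _ _)) (mul_nonneg hb (mono _ _))
  have h1 : inner ℝ w x ≤ (‖w‖ ^ 2 + ‖x‖ ^ 2) / 2 := by
    nlinarith [real_inner_le_norm w x, sq_nonneg (‖w‖ - ‖x‖)]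
  have h2 : ε * ‖x‖ ^ 2 ≤ R := by
    have h3 := mul_le_mul_of_nonneg_left h1 hε.le
    have h4 := mul_le_mul_of_nonneg_right hε1 (sq_nonneg ‖w‖)
    have h5 := le_abs_self K
    rw [hR]
    linarith
  rw [dist_eq_norm, hAx, sub_sub_cancel, norm_smul, Real.norm_of_nonneg hε.le]
  refine lt_of_pow_lt_pow_left₀ 2 hδ.le ?_
  have h6 := mul_le_mul_of_nonneg_left h2 hε.le
  nlinarith

theorem convex_closure_range [CompleteSpace G] (hA : IsCocoercive l A) (hl : 0 < l) :
    Convex ℝ (closure (Set.range A)) := by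
  intro x hx y hy a b ha hb hab
  rw [← closure_closure]
  refine map_mem_closure₂ (f := fun x y => a • x + b • y) (by fun_prop) hx hy ?_
  rintro _ ⟨p, rfl⟩ _ ⟨q, rfl⟩
  exact hA.combination_mem_closure_range hl p q ha hb hab

end IsCocoercive

/-- The variational inequality for an element of minimal norm of a convex set. -/
theorem sq_norm_le_inner_of_forall_norm_le {K : Set G} (hK : Convex ℝ K) {v : G} (hv : v ∈ K)
    (hmin : ∀ y ∈ K, ‖v‖ ≤ ‖y‖) {y : G} (hy : y ∈ K) : ‖v‖ ^ 2 ≤ inner ℝ y v := by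
  have : Nonempty K := ⟨⟨v, hv⟩⟩
  have h := (norm_eq_iInf_iff_real_inner_le_zero hK (u := 0) hv).1
    (le_antisymm (le_ciInf fun w => by simpa using hmin w w.2)
      (ciInf_le (f := fun w : K => ‖(0 : G) - w‖)
        ⟨0, Set.forall_mem_range.2 fun w => norm_nonneg _⟩ ⟨v, hv⟩)) y hy
  rw [zero_sub, inner_neg_left, inner_sub_right, real_inner_self_eq_norm_sq,
    real_inner_comm] at h
  linarith

theorem existsUnique_forall_norm_le {K : Set G} (hK : Convex ℝ K) (hc : IsComplete K)
    (hne : K.Nonempty) : ∃! v, v ∈ K ∧ ∀ y ∈ K, ‖v‖ ≤ ‖y‖ := by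
  obtain ⟨v, hv, hmin⟩ := exists_norm_eq_iInf_of_complete_convex hne hc hK 0
  refine ⟨v, ⟨hv, fun y hy => ?_⟩, ?_⟩
  · have := ciInf_le (f := fun w : K => ‖(0 : G) - w‖)
        ⟨0, Set.forall_mem_range.2 fun w => norm_nonneg _⟩ ⟨y, hy⟩
    rw [← hmin] at this
    simpa using this
  · rintro w ⟨hw, hwmin⟩
    have h := sq_norm_le_inner_of_forall_norm_le hK hw hwmin hv
    have h' := hwmin v hv
    have h2 : ‖v‖ ≤ ‖w‖ := by
      have := ciInf_le (f := fun w : K => ‖(0 : G) - w‖)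
        ⟨0, Set.forall_mem_range.2 fun w => norm_nonneg _⟩ ⟨w, hw⟩
      rw [← hmin] at this
      simpa using this
    have h3 : ‖w - v‖ ^ 2 ≤ 0 := by
      rw [norm_sub_sq_real, real_inner_comm]
      nlinarith [norm_nonneg v, norm_nonneg w]
    rw [← sub_eq_zero, ← norm_eq_zero]
    exact pow_eq_zero_iff two_ne_zero |>.1 (le_antisymm h3 (sq_nonneg _))

/-! ### The deterministic iteration -/

namespace IsCocoercive

variable {l : ℝ} {A : G → G} {a : ℝ}

theorem norm_iterate_step_sub_le (hA : IsCocoercive l A) (ha : 0 ≤ a) (hal : a ≤ l) (x y : G)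
    (n : ℕ) : ‖(fun x => x - a • A x)^[n] x - (fun x => x - a • A x)^[n] y‖ ≤ ‖x - y‖ := by
  induction n generalizing x y with
  | zero => simp
  | succ n ih =>
    rw [Function.iterate_succ_apply, Function.iterate_succ_apply]
    exact (ih _ _).trans (hA.norm_step_sub_le ha hal x y)

theorem norm_iterate_step_sub_self_le (hA : IsCocoercive l A) (ha : 0 ≤ a) (hal : a ≤ l) (x : G)
    (n : ℕ) : ‖(fun x => x - a • A x)^[n] x - x‖ ≤ n * (a * ‖A x‖) := by
  induction n with
  | zero => simp
  | succ n ih =>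
    have h := hA.norm_iterate_step_sub_le ha hal (x - a • A x) x n
    rw [sub_sub_cancel_left, norm_neg, norm_smul, Real.norm_of_nonneg ha] at h
    rw [Function.iterate_succ_apply]
    refine (norm_sub_le_norm_sub_add_norm_sub _ ((fun x => x - a • A x)^[n] x) _).trans ?_
    push_cast
    linarith

/-- The displacement `a • A y` does not grow along the deterministic iteration. -/
theorem norm_apply_iterate_step_le (hA : IsCocoercive l A) (ha : 0 < a) (hal : a ≤ l) (x : G)
    (n : ℕ) : ‖A ((fun x => x - a • A x)^[n] x)‖ ≤ ‖A x‖ := by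
  have h := hA.norm_iterate_step_sub_le ha.le hal (x - a • A x) x n
  rw [← Function.iterate_succ_apply (fun x => x - a • A x), Function.iterate_succ_apply',
    sub_sub_cancel_left, sub_sub_cancel_left, norm_neg, norm_neg, norm_smul, norm_smul] at h
  exact le_of_mul_le_mul_left h (norm_pos_iff.2 ha.ne')

/-- **Pazy's theorem.** The inner products of the iterates with `v` drift at rate at least
`a * ‖v‖ ^ 2` by the variational inequality, while comparison with trajectories started at points
`z` with `‖A z‖` close to `‖v‖` bounds the speed of the iterates by `a * ‖v‖`. -/
theorem tendsto_inv_smul_iterate_step [CompleteSpace G] (hA : IsCocoercive l A) (ha : 0 ≤ a)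
    (hal : a ≤ l) (hl : 0 < l) {v : G} (hv : v ∈ closure (Set.range A))
    (hmin : ∀ y ∈ closure (Set.range A), ‖v‖ ≤ ‖y‖) (x : G) :
    Tendsto (fun n : ℕ => (n : ℝ)⁻¹ • (fun x => x - a • A x)^[n] x) atTop (𝓝 (-(a • v))) := by
  set N : G → G := fun x => x - a • A x
  set u : ℕ → G := fun n => (n : ℝ)⁻¹ • (x - N^[n] x) with hu
  have hlow : ∀ n : ℕ, n * (a * ‖v‖ ^ 2) ≤ inner ℝ (x - N^[n] x) v := by
    intro n
    induction n with
    | zero => simp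
    | succ n ih =>
      have h := sq_norm_le_inner_of_forall_norm_le (hA.convex_closure_range hl) hv hmin
        (subset_closure (Set.mem_range_self (N^[n] x)))
      have e : x - N^[n + 1] x = (x - N^[n] x) + a • A (N^[n] x) := by
        rw [Function.iterate_succ_apply']
        change x - (N^[n] x - a • A (N^[n] x)) = _
        abel
      rw [e, inner_add_left, inner_smul_left, conj_trivial]
      push_cast
      linarith [mul_le_mul_of_nonneg_left h ha]
  have hlow' : ∀ n : ℕ, 0 < n → a * ‖v‖ ^ 2 ≤ inner ℝ (u n) v := by
    intro n hn
    have hn' : (0 : ℝ) < n := by exact_mod_cast hn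
    rw [hu, inner_smul_left, conj_trivial, inv_mul_eq_div, le_div_iff₀ hn', mul_comm]
    exact hlow n
  have hnorm : Tendsto (fun n => ‖u n‖) atTop (𝓝 (a * ‖v‖)) := by
    refine tendsto_order.2 ⟨fun r hr => ?_, fun r hr => ?_⟩
    · filter_upwards [eventually_gt_atTop 0] with n hn
      refine hr.trans_le ?_
      by_cases h0 : ‖v‖ = 0
      · rw [h0, mul_zero]; positivity
      · have : 0 < ‖v‖ := lt_of_le_of_ne (norm_nonneg _) (Ne.symm h0)
        refine le_of_mul_le_mul_right ?_ this
        have := (hlow' n hn).trans (real_inner_le_norm _ _)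
        linarith [this, pow_two ‖v‖, mul_assoc a ‖v‖ ‖v‖]
    · -- a trajectory from `z` moves by less than `r` per step, since `‖A z‖` is close to `‖v‖`
      obtain ⟨z, hz⟩ : ∃ z, a * ‖A z‖ < r := by
        have hcont : ContinuousAt (fun w : G => a * ‖w‖) v := by fun_prop
        obtain ⟨_, hw, z, rfl⟩ := mem_closure_iff_nhds.1 hv _ (hcont.eventually_lt_const hr)
        exact ⟨z, hw⟩
      have hlim : Tendsto (fun n : ℕ => (n : ℝ)⁻¹ * (2 * ‖x - z‖) + a * ‖A z‖) atTop
          (𝓝 (0 * (2 * ‖x - z‖) + a * ‖A z‖)) :=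
        (tendsto_inv_atTop_nhds_zero_nat.mul_const _).add_const _
      rw [zero_mul, zero_add] at hlim
      filter_upwards [hlim.eventually_lt_const hz, eventually_gt_atTop 0] with n hn hn0
      refine lt_of_le_of_lt ?_ hn
      have hn' : (0 : ℝ) < n := by exact_mod_cast hn0
      have h1 := hA.norm_iterate_step_sub_le ha hal x z n
      have h2 := hA.norm_iterate_step_sub_self_le ha hal z n
      have h3 : ‖x - N^[n] x‖ ≤ 2 * ‖x - z‖ + n * (a * ‖A z‖) := by
        have e : x - N^[n] x = (x - z) - (N^[n] z - z) - (N^[n] x - N^[n] z) := by abel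
        rw [e]
        refine (_root_.norm_sub_le _ _).trans ?_
        have := _root_.norm_sub_le (x - z) (N^[n] z - z)
        linarith
      rw [hu, norm_smul, norm_inv, Real.norm_natCast]
      calc (n : ℝ)⁻¹ * ‖x - N^[n] x‖ ≤ (n : ℝ)⁻¹ * (2 * ‖x - z‖ + n * (a * ‖A z‖)) := by gcongr
        _ = _ := by field_simp
  have hsq : Tendsto (fun n => ‖u n - a • v‖ ^ 2) atTop (𝓝 0) := by
    have hup : Tendsto (fun n => ‖u n‖ ^ 2 - (a * ‖v‖) ^ 2) atTop (𝓝 0) := by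
      have := (hnorm.pow 2).sub_const ((a * ‖v‖) ^ 2)
      rwa [sub_self] at this
    refine squeeze_zero' (Eventually.of_forall fun n => sq_nonneg _) ?_ hup
    filter_upwards [eventually_gt_atTop 0] with n hn
    rw [norm_sub_sq_real, inner_smul_right, norm_smul a v, Real.norm_of_nonneg ha]
    nlinarith [mul_le_mul_of_nonneg_left (hlow' n hn) ha]
  have hun : Tendsto u atTop (𝓝 (a • v)) := by
    rw [tendsto_iff_norm_sub_tendsto_zero]
    simpa using hsq.sqrt
  have hx : Tendsto (fun n : ℕ => (n : ℝ)⁻¹ • x) atTop (𝓝 0) := by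
    simpa using (tendsto_inv_atTop_nhds_zero_nat (𝕜 := ℝ)).smul_const x
  have := hx.sub hun
  rw [zero_sub] at this
  refine this.congr fun n => ?_
  rw [hu, ← smul_sub, sub_sub_cancel]

end IsCocoercive
end Cocoercive

/-! ### Conditional expectation of a function of an independent variable -/

section Freezing

/-- If `Y` is independent of the σ-algebra `m`, then a conditional expectation given `m` of a
function of `m`-measurable data and `Y` is computed by integrating over the law of `Y` with the
data frozen. -/
theorem condExp_ae_eq_integral_of_indep {Ω 𝕊 : Type*} {mΩ : MeasurableSpace Ω}
    [MeasurableSpace 𝕊] [StandardBorelSpace 𝕊] [Nonempty 𝕊] {P : Measure Ω}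
    [IsProbabilityMeasure P] {ν : Measure 𝕊} {Y : Ω → 𝕊} (hY : HasLaw Y ν P)
    {m : MeasurableSpace Ω} (hm : m ≤ mΩ)
    (hind : Indep m (MeasurableSpace.comap Y inferInstance) P) {f : Ω × 𝕊 → ℝ}
    (hf : StronglyMeasurable[m.prod inferInstance] f)
    (hint : Integrable (fun ω => f (ω, Y ω)) P) :
    P[fun ω => f (ω, Y ω) | m] =ᵐ[P] fun ω => ∫ s, f (ω, s) ∂ν := by
  have hid : @Measurable Ω Ω mΩ m id := measurable_id'' hm
  have hind' : @IndepFun Ω Ω 𝕊 mΩ m _ id Y P := by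
    rw [IndepFun_iff_Indep, MeasurableSpace.comap_id]
    exact hind
  have hmap := (@indepFun_iff_map_prod_eq_prod_map_map Ω Ω 𝕊 mΩ P id Y m _ _
    hid.aemeasurable hY.aemeasurable).1 hind'
  have : IsProbabilityMeasure ν := hY.map_eq ▸ Measure.isProbabilityMeasure_map hY.aemeasurable
  have hcd := @condDistrib_ae_eq_of_measure_eq_compProd Ω Ω 𝕊 _ _ _ mΩ P _ Y m id
    hY.aemeasurable (@Kernel.const Ω 𝕊 m _ ν) _ (by
      rw [hmap, hY.map_eq, Measure.compProd_const])
  have h := @condExp_prod_ae_eq_integral_condDistrib Ω Ω 𝕊 ℝ _ _ _ _ mΩ P _ id Y m f _ _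
    hid hY.aemeasurable hf hint
  rw [MeasurableSpace.comap_id] at h
  refine h.trans ?_
  filter_upwards [ae_of_ae_map hid.aemeasurable hcd] with ω hω
  simp only [hω]
  rfl

end Freezing

/-! ### A supermartingale criterion -/

section AlmostSupermartingale

variable {Ω : Type*} {mΩ : MeasurableSpace Ω} {P : Measure Ω} [IsProbabilityMeasure P]

/-- A nonnegative supermartingale whose expectations tend to zero tends to zero almost surely: it
converges almost surely, and the limit is identified along a subsequence because the convergence to
zero holds in `L¹`, hence in measure. -/
theorem MeasureTheory.Supermartingale.ae_tendsto_zero {F : Filtration ℕ mΩ} {W : ℕ → Ω → ℝ}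
    (hW : Supermartingale W F P) (h0 : ∀ n ω, 0 ≤ W n ω)
    (hlim : Tendsto (fun n => ∫ ω, W n ω ∂P) atTop (𝓝 0)) :
    ∀ᵐ ω ∂P, Tendsto (fun n => W n ω) atTop (𝓝 0) := by
  have hnorm : ∀ n, eLpNorm (W n) 1 P = ENNReal.ofReal (∫ ω, W n ω ∂P) := fun n => by
    rw [eLpNorm_one_eq_lintegral_enorm,
      ofReal_integral_eq_lintegral_ofReal (hW.integrable n) (Eventually.of_forall (h0 n))]
    exact lintegral_congr fun ω => Real.enorm_of_nonneg (h0 n ω)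
  have hae : ∀ᵐ ω ∂P, ∃ c, Tendsto (fun n => (-W) n ω) atTop (𝓝 c) := by
    refine hW.neg.exists_ae_tendsto_of_bdd (R := (∫ ω, W 0 ω ∂P).toNNReal) fun n => ?_
    have h := hW.setIntegral_le (Nat.zero_le n) MeasurableSet.univ
    rw [setIntegral_univ, setIntegral_univ] at h
    rw [Pi.neg_apply, eLpNorm_neg, hnorm]
    exact ENNReal.ofReal_le_ofReal h
  have hmeas : TendstoInMeasure P W atTop (fun _ => (0 : ℝ)) := by
    refine tendstoInMeasure_of_tendsto_eLpNorm one_ne_zero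
      (fun n => (hW.integrable n).aestronglyMeasurable) aestronglyMeasurable_const ?_
    have : Tendsto (fun n => ENNReal.ofReal (∫ ω, W n ω ∂P)) atTop (𝓝 0) := by
      simpa using ENNReal.tendsto_ofReal hlim
    refine this.congr fun n => ?_
    rw [← hnorm]
    congr 1
    ext ω
    simp
  obtain ⟨ns, hns, hsub⟩ := hmeas.exists_seq_tendsto_ae
  filter_upwards [hae, hsub] with ω ⟨c, hc⟩ hω
  have hc' : Tendsto (fun n => W n ω) atTop (𝓝 (-c)) := by simpa using hc.neg
  rwa [tendsto_nhds_unique (hc'.comp hns.tendsto_atTop) hω] at hc'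

/-- If the conditional expectation of a nonnegative process grows by at most a constant in each
step, then the process is almost surely of order `o(n ^ 2)`. The witness is the nonnegative
supermartingale `(D n + C * (n + 1)) / (n + 1) ^ 2`, whose expectation is `O(1 / n)`. -/
theorem ae_tendsto_div_sq_of_condExp_le {F : Filtration ℕ mΩ} {D : ℕ → Ω → ℝ} {C : ℝ}
    (hC : 0 ≤ C) (hadp : StronglyAdapted F D) (hint : ∀ n, Integrable (D n) P)
    (h0 : ∀ n ω, 0 ≤ D n ω) (hstep : ∀ n, P[D (n + 1) | F n] ≤ᵐ[P] fun ω => D n ω + C) :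
    ∀ᵐ ω ∂P, Tendsto (fun n : ℕ => D n ω / (n + 1 : ℝ) ^ 2) atTop (𝓝 0) := by
  set W : ℕ → Ω → ℝ := fun n ω => ((n + 1 : ℝ) ^ 2)⁻¹ * (D n ω + C * (n + 1)) with hWd
  have hintW : ∀ n, Integrable (W n) P := fun n =>
    ((hint n).add (integrable_const _)).const_mul _
  have hW : Supermartingale W F P := by
    refine supermartingale_nat (fun n => ?_) hintW fun n => ?_
    · exact ((hadp n).add stronglyMeasurable_const).const_mul _
    · have e1 : P[W (n + 1) | F n] =ᵐ[P] fun ω => (((n + 1 : ℕ) + 1 : ℝ) ^ 2)⁻¹ *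
          ((P[D (n + 1) | F n]) ω + C * ((n + 1 : ℕ) + 1)) := by
        refine (condExp_smul (((n + 1 : ℕ) + 1 : ℝ) ^ 2)⁻¹
          (D (n + 1) + fun _ => C * ((n + 1 : ℕ) + 1 : ℝ)) (F n)).trans ?_
        filter_upwards [condExp_add (hint (n + 1))
          (integrable_const (C * ((n + 1 : ℕ) + 1 : ℝ))) (F n)] with ω hω
        rw [Pi.smul_apply, hω, Pi.add_apply, condExp_const (F.le n), smul_eq_mul]
      filter_upwards [e1, hstep n] with ω h1 h2
      rw [h1]
      have hn : (0 : ℝ) ≤ n := Nat.cast_nonneg n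
      have hD := h0 n ω
      simp only [hWd]
      push_cast
      calc ((n + 1 + 1 : ℝ) ^ 2)⁻¹ * ((P[D (n + 1) | F n]) ω + C * (n + 1 + 1))
          ≤ ((n + 1 + 1 : ℝ) ^ 2)⁻¹ * (D n ω + C + C * (n + 1 + 1)) := by gcongr
        _ ≤ ((n + 1 : ℝ) ^ 2)⁻¹ * (D n ω + C * (n + 1)) := by
          rw [inv_mul_eq_div, inv_mul_eq_div, div_le_div_iff₀ (by positivity) (by positivity)]
          nlinarith [mul_nonneg hD hn, mul_nonneg hC hn, mul_nonneg (mul_nonneg hC hn) hn]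
  have hW0 : ∀ n ω, 0 ≤ W n ω := fun n ω => by
    have := h0 n ω
    simp only [hWd]
    positivity
  have hED : ∀ n : ℕ, ∫ ω, D n ω ∂P ≤ ∫ ω, D 0 ω ∂P + C * n := by
    intro n
    induction n with
    | zero => simp
    | succ n ih =>
      have h := integral_mono_ae integrable_condExp ((hint n).add (integrable_const C)) (hstep n)
      rw [integral_condExp (F.le n)] at h
      have h' : ∫ ω, (D n + (fun _ => C : Ω → ℝ)) ω ∂P = ∫ ω, D n ω ∂P + C := by
        rw [integral_add' (hint n) (integrable_const C)]
        simp
      rw [h'] at h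
      push_cast
      linarith
  have hlim : Tendsto (fun n => ∫ ω, W n ω ∂P) atTop (𝓝 0) := by
    set c := ∫ ω, D 0 ω ∂P with hc
    have hc0 : 0 ≤ c := integral_nonneg (h0 0)
    have hup : Tendsto (fun n : ℕ => (c + 2 * C) * (1 / ((n : ℝ) + 1))) atTop (𝓝 0) := by
      simpa using tendsto_one_div_add_atTop_nhds_zero_nat.const_mul (c + 2 * C)
    refine squeeze_zero (fun n => integral_nonneg (hW0 n)) (fun n => ?_) hup
    have e : ∫ ω, W n ω ∂P = ((n + 1 : ℝ) ^ 2)⁻¹ * (∫ ω, D n ω ∂P + C * (n + 1)) := by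
      simp only [hWd]
      rw [integral_const_mul, integral_add (hint n) (integrable_const _)]
      simp
    rw [e, inv_mul_eq_div, mul_one_div, div_le_div_iff₀ (by positivity) (by positivity)]
    have hn : (0 : ℝ) ≤ n := Nat.cast_nonneg n
    have h1 : ∫ ω, D n ω ∂P + C * (n + 1) ≤ (c + 2 * C) * (n + 1) := by
      nlinarith [hED n, mul_nonneg hc0 hn]
    nlinarith
  filter_upwards [hW.ae_tendsto_zero hW0 hlim] with ω hω
  refine squeeze_zero (fun n => div_nonneg (h0 n ω) (by positivity)) (fun n => ?_) hω
  rw [div_eq_inv_mul]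
  have hn : (0 : ℝ) ≤ n := Nat.cast_nonneg n
  simp only [hWd]
  gcongr
  exact le_add_of_nonneg_right (by positivity)

end AlmostSupermartingale

/-! ### The randomized iteration -/

section Randomized

variable {G : Type*} [NormedAddCommGroup G] [InnerProductSpace ℝ G] {m : ℕ}

/-- The random mixture `∑ i, s i • Q i u` of the images of `u` under the operators `Q i`. When the
`Q i` are the coordinate projections of a direct sum, this scales the `i`th block of `u` by
`s i`. -/
noncomputable def mixture (Q : Fin m → G →L[ℝ] G) (s : Fin m → ℝ) (u : G) : G :=
  ∑ i, s i • Q i u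

/-- The iteration `x (k + 1) = x k - mixture Q (s k) (A (x k))`. -/
noncomputable def mixtureIter (Q : Fin m → G →L[ℝ] G) (A : G → G) (x0 : G)
    (s : ℕ → Fin m → ℝ) : ℕ → G
  | 0 => x0
  | k + 1 => mixtureIter Q A x0 s k - mixture Q (s k) (A (mixtureIter Q A x0 s k))

variable {Q : Fin m → G →L[ℝ] G} {A : G → G} {ν : Measure (Fin m → ℝ)} {α β l : ℝ}

theorem continuous_mixture : Continuous fun p : (Fin m → ℝ) × G => mixture Q p.1 p.2 := by
  unfold mixture
  fun_prop

theorem norm_mixture_le {s : Fin m → ℝ} (hs : ∀ i, s i ∈ Set.Icc (0 : ℝ) 1) (u : G) :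
    ‖mixture Q s u‖ ≤ (∑ i, ‖Q i‖) * ‖u‖ := by
  rw [Finset.sum_mul]
  refine norm_sum_le_of_le _ fun i _ => ?_
  rw [norm_smul, Real.norm_of_nonneg (hs i).1]
  calc s i * ‖Q i u‖ ≤ 1 * ‖Q i u‖ := by gcongr; exact (hs i).2
    _ ≤ ‖Q i‖ * ‖u‖ := by rw [one_mul]; exact (Q i).le_opNorm u

theorem integrable_coord [IsProbabilityMeasure ν] (hν : RCFPI.IsSelectionLaw ν α) (i : Fin m) :
    Integrable (fun s : Fin m → ℝ => s i) ν := by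
  refine Integrable.of_bound (measurable_pi_apply i).aestronglyMeasurable 1 ?_
  filter_upwards [hν.mem_Icc] with s hs
  rw [Real.norm_of_nonneg (hs i).1]
  exact (hs i).2

theorem integrable_sq_norm_mixture [IsProbabilityMeasure ν] (hν : RCFPI.IsSelectionLaw ν α)
    (u : G) : Integrable (fun s => ‖mixture Q s u‖ ^ 2) ν := by
  have hc : Continuous fun s : Fin m → ℝ => ‖mixture Q s u‖ ^ 2 := by
    unfold mixture
    fun_prop
  refine Integrable.of_bound hc.aestronglyMeasurable (((∑ i, ‖Q i‖) * ‖u‖) ^ 2) ?_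
  filter_upwards [hν.mem_Icc] with s hs
  rw [Real.norm_of_nonneg (sq_nonneg _)]
  gcongr
  exact norm_mixture_le hs u

theorem inner_mixture (s : Fin m → ℝ) (u w : G) :
    inner ℝ w (mixture Q s u) = ∑ i, s i * inner ℝ w (Q i u) := by
  simp only [mixture, inner_sum, inner_smul_right]

theorem integrable_inner_mixture [IsProbabilityMeasure ν] (hν : RCFPI.IsSelectionLaw ν α)
    (u w : G) : Integrable (fun s => inner ℝ w (mixture Q s u)) ν := by
  simp only [inner_mixture]
  exact integrable_finsetSum _ fun i _ => (integrable_coord hν i).mul_const _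

/-- If the `Q i` sum to the identity, then the mean of `mixture Q s u` is `α • u`. -/
theorem integral_inner_mixture [IsProbabilityMeasure ν] (hν : RCFPI.IsSelectionLaw ν α)
    (hQ : ∀ u, ∑ i, Q i u = u) (u w : G) :
    ∫ s, inner ℝ w (mixture Q s u) ∂ν = α * inner ℝ w u := by
  simp only [inner_mixture]
  rw [integral_finsetSum _ fun i _ => (integrable_coord hν i).mul_const _]
  simp only [integral_mul_const, hν.mean]
  rw [← Finset.mul_sum, ← inner_sum, hQ]

/-- The mean squared distance of one randomized step from `x` to one deterministic step from `y`.
Because `β < α * l`, cocoercivity leaves a positive multiple of `‖A x - A y‖ ^ 2` to absorb the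
cross term between `A x - A y` and `A y`. -/
theorem integral_sq_norm_step_sub_le [IsProbabilityMeasure ν] (hν : RCFPI.IsSelectionLaw ν α)
    (hα : 0 ≤ α) (hQ : ∀ u, ∑ i, Q i u = u) (hA : IsCocoercive l A)
    (hsq : ∀ u, ∫ s, ‖mixture Q s u‖ ^ 2 ∂ν ≤ β * ‖u‖ ^ 2) (hβ : β < α * l) (x y : G) :
    ∫ s, ‖(x - mixture Q s (A x)) - (y - α • A y)‖ ^ 2 ∂ν ≤
      ‖x - y‖ ^ 2 + ((β - α ^ 2) ^ 2 / (α * l - β) + |β - α ^ 2|) * ‖A y‖ ^ 2 := by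
  obtain ⟨d, hd⟩ : ∃ d, A x = A y + d := ⟨A x - A y, by abel⟩
  have hco := hA x y
  have hsqx := hsq (A x)
  have e : ∀ s, ‖(x - mixture Q s (A x)) - (y - α • A y)‖ ^ 2 = ‖(x - y) + α • A y‖ ^ 2
      - 2 * inner ℝ ((x - y) + α • A y) (mixture Q s (A x)) + ‖mixture Q s (A x)‖ ^ 2 := by
    intro s
    rw [← norm_sub_sq_real]
    congr 2
    abel
  simp only [e]
  have hi := (integrable_inner_mixture (Q := Q) hν (A x) ((x - y) + α • A y)).const_mul 2
  have hi' : Integrable (fun s => ‖(x - y) + α • A y‖ ^ 2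
      - 2 * inner ℝ ((x - y) + α • A y) (mixture Q s (A x))) ν := (integrable_const _).sub hi
  rw [integral_add hi' (integrable_sq_norm_mixture hν _), integral_sub (integrable_const _) hi,
    integral_const_mul, integral_inner_mixture hν hQ, integral_const, probReal_univ, one_smul]
  rw [hd] at hco hsqx ⊢
  rw [add_sub_cancel_left] at hco
  set b := A y
  set w := x - y
  set κ := β - α ^ 2 with hκ
  set γ := α * l - β with hγ
  have hγ0 : 0 < γ := sub_pos.2 hβ
  -- Young's inequality for the cross term
  have hyoung : 2 * κ * inner ℝ b d ≤ γ * ‖d‖ ^ 2 + κ ^ 2 / γ * ‖b‖ ^ 2 := by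
    have h1 : 0 ≤ ‖(κ / γ) • b - d‖ ^ 2 := sq_nonneg _
    rw [norm_sub_sq_real, norm_smul, inner_smul_left, mul_pow, Real.norm_eq_abs, sq_abs,
      conj_trivial] at h1
    have h2 := mul_nonneg hγ0.le h1
    have h3 : γ * ((κ / γ) ^ 2 * ‖b‖ ^ 2 - 2 * (κ / γ * inner ℝ b d) + ‖d‖ ^ 2)
        = κ ^ 2 / γ * ‖b‖ ^ 2 - 2 * κ * inner ℝ b d + γ * ‖d‖ ^ 2 := by
      field_simp
    linarith
  have habs : κ * ‖b‖ ^ 2 ≤ |κ| * ‖b‖ ^ 2 := by gcongr; exact le_abs_self κ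
  have e1 : ‖w + α • b‖ ^ 2 = ‖w‖ ^ 2 + 2 * (α * inner ℝ w b) + α ^ 2 * ‖b‖ ^ 2 := by
    rw [norm_add_sq_real, norm_smul, mul_pow, Real.norm_eq_abs, sq_abs, inner_smul_right]
  have e2 : inner ℝ (w + α • b) (b + d)
      = inner ℝ w b + inner ℝ w d + α * (‖b‖ ^ 2 + inner ℝ b d) := by
    simp only [inner_add_left, inner_add_right, inner_smul_left, conj_trivial,
      real_inner_self_eq_norm_sq]
    ring
  rw [norm_add_sq_real b d] at hsqx
  rw [e1, e2]
  have hco' := mul_le_mul_of_nonneg_left hco hα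
  have e3 : γ * ‖d‖ ^ 2 = α * (l * ‖d‖ ^ 2) - β * ‖d‖ ^ 2 := by rw [hγ]; ring
  have e4 : κ * ‖b‖ ^ 2 = β * ‖b‖ ^ 2 - α ^ 2 * ‖b‖ ^ 2 := by rw [hκ]; ring
  have e5 : 2 * κ * inner ℝ b d = 2 * β * inner ℝ b d - 2 * α ^ 2 * inner ℝ b d := by
    rw [hκ]; ring
  linarith

variable {Ω : Type*} {mΩ : MeasurableSpace Ω} {P : Measure Ω}
  {I : ℕ → Ω → Fin m → ℝ} {F : Filtration ℕ mΩ}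

theorem stronglyMeasurable_mixtureIter (hA : Continuous A) (x0 : G)
    (hI : ∀ n, Measurable[F (n + 1)] (I n)) (n : ℕ) :
    StronglyMeasurable[F n] fun ω => mixtureIter Q A x0 (fun j => I j ω) n := by
  induction n with
  | zero => exact stronglyMeasurable_const
  | succ n ih =>
    have h : StronglyMeasurable[F (n + 1)] fun ω => mixtureIter Q A x0 (fun j => I j ω) n :=
      ih.mono (F.mono n.le_succ)
    exact h.sub (continuous_mixture.comp_stronglyMeasurable
      ((hI n).stronglyMeasurable.prodMk (hA.comp_stronglyMeasurable h)))

/-- Each iterate is almost surely bounded, which makes its squared distances integrable. -/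
theorem exists_ae_norm_mixtureIter_le (hν : RCFPI.IsSelectionLaw ν α)
    (hI : ∀ n, HasLaw (I n) ν P) (hA : IsCocoercive l A) (hl : 0 < l) (x0 : G) (n : ℕ) :
    ∃ R, ∀ᵐ ω ∂P, ‖mixtureIter Q A x0 (fun j => I j ω) n‖ ≤ R := by
  induction n with
  | zero => exact ⟨‖x0‖, Eventually.of_forall fun ω => le_rfl⟩
  | succ n ih =>
    obtain ⟨R, hR⟩ := ih
    refine ⟨R + (∑ i, ‖Q i‖) * (2 / l * R + ‖A 0‖), ?_⟩
    have hmem : ∀ᵐ s ∂(P.map (I n)), ∀ i, s i ∈ Set.Icc (0 : ℝ) 1 := by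
      rw [(hI n).map_eq]
      exact hν.mem_Icc
    filter_upwards [hR, ae_of_ae_map (hI n).aemeasurable hmem] with ω h1 h2
    set x := mixtureIter Q A x0 (fun j => I j ω) n
    have h3 : ‖A x‖ ≤ 2 / l * R + ‖A 0‖ := by
      have h4 := hA.norm_sub_le hl x 0
      rw [sub_zero] at h4
      have h5 : 2 / l * ‖x‖ ≤ 2 / l * R := by gcongr
      linarith [norm_le_norm_sub_add (A x) (A 0)]
    refine (norm_sub_le _ _).trans (add_le_add h1 ((norm_mixture_le h2 _).trans ?_))
    gcongr

/-- Almost sure convergence of the normalized randomized iterates: their squared distance to the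
deterministic iterates `y (k + 1) = y k - α • A (y k)` grows in conditional mean by at most a
constant per step. -/
theorem ae_tendsto_inv_smul_mixtureIter [CompleteSpace G] [IsProbabilityMeasure P]
    (hν : RCFPI.IsSelectionLaw ν α)
    (hα : 0 < α) (hl : 0 < l) (hαl : α ≤ l) (hQ : ∀ u, ∑ i, Q i u = u) (hA : IsCocoercive l A)
    (hsq : ∀ u, ∫ s, ‖mixture Q s u‖ ^ 2 ∂ν ≤ β * ‖u‖ ^ 2) (hβ : β < α * l)
    (hI : ∀ n, HasLaw (I n) ν P) (hmeas : ∀ n, Measurable[F (n + 1)] (I n))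
    (hind : ∀ n, Indep (F n) (MeasurableSpace.comap (I n) inferInstance) P)
    {v : G} (hv : v ∈ closure (Set.range A)) (hmin : ∀ y ∈ closure (Set.range A), ‖v‖ ≤ ‖y‖)
    (x0 : G) :
    ∀ᵐ ω ∂P, Tendsto (fun k : ℕ => (k : ℝ)⁻¹ • mixtureIter Q A x0 (fun j => I j ω) k) atTop
      (𝓝 (-(α • v))) := by
  have : IsProbabilityMeasure ν :=
    (hI 0).map_eq ▸ Measure.isProbabilityMeasure_map (hI 0).aemeasurable
  have hAc := hA.continuous hl
  set X : ℕ → Ω → G := fun n ω => mixtureIter Q A x0 (fun j => I j ω) n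
  set y : ℕ → G := fun n => (fun x => x - α • A x)^[n] x0 with hy
  have hys : ∀ n, y (n + 1) = y n - α • A (y n) := fun n => Function.iterate_succ_apply' _ _ _
  set K := (β - α ^ 2) ^ 2 / (α * l - β) + |β - α ^ 2| with hK
  have hK0 : 0 ≤ K := add_nonneg (div_nonneg (sq_nonneg _) (sub_pos.2 hβ).le) (abs_nonneg _)
  set D : ℕ → Ω → ℝ := fun n ω => ‖X n ω - y n‖ ^ 2 with hD
  have hXm : ∀ n, StronglyMeasurable[F n] (X n) :=
    stronglyMeasurable_mixtureIter hAc x0 hmeas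
  have hDm : StronglyAdapted F D := fun n =>
    ((hXm n).sub stronglyMeasurable_const).norm.pow 2
  have hDint : ∀ n, Integrable (D n) P := fun n => by
    obtain ⟨R, hR⟩ := exists_ae_norm_mixtureIter_le (Q := Q) hν hI hA hl x0 n
    refine Integrable.of_bound ((hDm n).mono (F.le n)).aestronglyMeasurable
      ((R + ‖y n‖) ^ 2) ?_
    filter_upwards [hR] with ω hω
    rw [Real.norm_of_nonneg (sq_nonneg _)]
    have := norm_sub_le (X n ω) (y n)
    exact pow_le_pow_left₀ (norm_nonneg _) (this.trans (by gcongr)) 2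
  have hstep : ∀ n, P[D (n + 1) | F n] ≤ᵐ[P] fun ω => D n ω + K * ‖A x0‖ ^ 2 := fun n => by
    have hg : Continuous fun p : G × (Fin m → ℝ) =>
        ‖(p.1 - mixture Q p.2 (A p.1)) - (y n - α • A (y n))‖ ^ 2 := by
      have := (continuous_mixture (Q := Q)).comp
        (continuous_snd.prodMk (hAc.comp continuous_fst) :
          Continuous fun p : G × (Fin m → ℝ) => (p.2, A p.1))
      exact (((continuous_fst.sub this).sub continuous_const).norm.pow 2)
    have hf : StronglyMeasurable[(F n).prod inferInstance] fun q : Ω × (Fin m → ℝ) =>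
        ‖(X n q.1 - mixture Q q.2 (A (X n q.1))) - (y n - α • A (y n))‖ ^ 2 := by
      let _ : MeasurableSpace Ω := F n
      exact hg.comp_stronglyMeasurable
        (((hXm n).comp_measurable measurable_fst).prodMk measurable_snd.stronglyMeasurable)
    have hDs : D (n + 1) = fun ω =>
        ‖(X n ω - mixture Q (I n ω) (A (X n ω))) - (y n - α • A (y n))‖ ^ 2 := by
      funext ω
      simp only [hD, hys n]
      rfl
    have hc := condExp_ae_eq_integral_of_indep (hI n) (F.le n) (hind n) hf (by
      rw [← hDs]; exact hDint (n + 1))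
    rw [← hDs] at hc
    filter_upwards [hc] with ω hω
    rw [hω]
    refine (integral_sq_norm_step_sub_le hν hα.le hQ hA hsq hβ (X n ω) (y n)).trans ?_
    have h1 := hA.norm_apply_iterate_step_le hα hαl x0 n
    simp only [hD]
    gcongr
  filter_upwards [ae_tendsto_div_sq_of_condExp_le (mul_nonneg hK0 (sq_nonneg _)) hDm hDint
    (fun n ω => sq_nonneg _) hstep] with ω hω
  have hdiff : Tendsto (fun n : ℕ => (n : ℝ)⁻¹ • (X n ω - y n)) atTop (𝓝 0) := by
    rw [tendsto_zero_iff_norm_tendsto_zero]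
    have h2 : Tendsto (fun n : ℕ => 2 * √(D n ω / (n + 1 : ℝ) ^ 2)) atTop (𝓝 0) := by
      simpa using hω.sqrt.const_mul 2
    refine squeeze_zero' (Eventually.of_forall fun n => norm_nonneg _) ?_ h2
    filter_upwards [eventually_ge_atTop 1] with n hn
    have hn' : (1 : ℝ) ≤ n := by exact_mod_cast hn
    rw [Real.sqrt_div' _ (sq_nonneg _), Real.sqrt_sq (norm_nonneg _),
      Real.sqrt_sq (by positivity), norm_smul, norm_inv, Real.norm_natCast, inv_mul_eq_div,
      mul_div_assoc', div_le_div_iff₀ (by positivity) (by positivity)]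
    nlinarith [norm_nonneg (X n ω - y n)]
  have hlim := hdiff.add (hA.tendsto_inv_smul_iterate_step hα.le hαl hl hv hmin x0)
  rw [zero_add] at hlim
  refine hlim.congr fun n => ?_
  rw [← smul_add, sub_add_cancel]

end Randomized

/-! ### Passage to the `M`-norm -/

section MNorm

universe u

variable {H : Type u} [NormedAddCommGroup H] [InnerProductSpace ℝ H] {M : H →L[ℝ] H}

/-- A copy of `H`, to be equipped with the inner product `⟪x, M y⟫`. -/
def MSpace (_ : H →L[ℝ] H) : Type u := H

namespace MSpace

instance : AddCommGroup (MSpace M) := inferInstanceAs (AddCommGroup H)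

instance : Module ℝ (MSpace M) := inferInstanceAs (Module ℝ H)

/-- The identity map from `H` to its copy. -/
def equiv (M : H →L[ℝ] H) : H ≃ₗ[ℝ] MSpace M := LinearEquiv.refl ℝ H

/-- The inner product `⟪x, M y⟫` on the copy of `H`. -/
@[reducible]
noncomputable def core (hM : RCFPI.IsPosDef M) : InnerProductSpace.Core ℝ (MSpace M) where
  inner x y := inner ℝ ((equiv M).symm x) (M ((equiv M).symm y))
  conj_inner_symm x y := by
    rw [conj_trivial, real_inner_comm]
    exact hM.symm _ _
  re_inner_nonneg x := by
    obtain ⟨c, hc, h⟩ := hM.pos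
    exact le_trans (by positivity) (h ((equiv M).symm x))
  add_left x y z := by rw [map_add, inner_add_left]
  smul_left x y r := by rw [map_smul, inner_smul_left]
  definite x hx := by
    obtain ⟨c, hc, h⟩ := hM.pos
    have h' := h ((equiv M).symm x)
    rw [hx] at h'
    have h2 : ‖(equiv M).symm x‖ ^ 2 ≤ 0 := by
      by_contra! hlt
      exact absurd h' (not_le.2 (mul_pos hc hlt))
    have h3 : ‖(equiv M).symm x‖ = 0 :=
      pow_eq_zero_iff two_ne_zero |>.1 (le_antisymm h2 (sq_nonneg _))
    simpa using h3

end MSpace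

/-- The `M`-norm is the norm of a Hilbert space that is linearly homeomorphic to the given one. -/
theorem RCFPI.IsPosDef.exists_equiv_norm_eq_mNorm (hM : RCFPI.IsPosDef M) :
    ∃ (G : Type u) (_ : NormedAddCommGroup G) (_ : InnerProductSpace ℝ G) (e : H ≃L[ℝ] G),
      ∀ x, ‖e x‖ = RCFPI.mNorm M x := by
  let _ : NormedAddCommGroup (MSpace M) := (MSpace.core hM).toNormedAddCommGroup
  let _ : InnerProductSpace ℝ (MSpace M) := .ofCore (MSpace.core hM).toCore
  have hnorm : ∀ x, ‖MSpace.equiv M x‖ = RCFPI.mNorm M x := fun x => rfl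
  obtain ⟨c, hc, h⟩ := hM.pos
  refine ⟨MSpace M, inferInstance, inferInstance,
    (MSpace.equiv M).toContinuousLinearEquivOfBounds (√‖M‖) (√c)⁻¹ (fun x => ?_) (fun x => ?_),
    hnorm⟩
  · rw [hnorm, RCFPI.mNorm]
    refine Real.sqrt_le_iff.2 ⟨by positivity, ?_⟩
    rw [mul_pow, Real.sq_sqrt (norm_nonneg _)]
    calc inner ℝ x (M x) ≤ ‖x‖ * ‖M x‖ := real_inner_le_norm _ _
      _ ≤ ‖x‖ * (‖M‖ * ‖x‖) := by gcongr; exact M.le_opNorm x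
      _ = ‖M‖ * ‖x‖ ^ 2 := by ring
  · obtain ⟨z, rfl⟩ := (MSpace.equiv M).surjective x
    rw [hnorm, LinearEquiv.symm_apply_apply, inv_mul_eq_div, le_div_iff₀ (Real.sqrt_pos.2 hc),
      RCFPI.mNorm]
    refine Real.le_sqrt_of_sq_le ?_
    rw [mul_pow, Real.sq_sqrt hc.le, mul_comm]
    exact h z

variable {G : Type*} [NormedAddCommGroup G] [InnerProductSpace ℝ G] {e : H ≃L[ℝ] G} {T : H → H}
  {θ : ℝ}

/-- The displacement of a `θ`-averaged operator is cocoercive. -/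
theorem RCFPI.IsAveraged.isCocoercive (hT : RCFPI.IsAveraged M θ T) (hθ : 0 < θ)
    (he : ∀ x, ‖e x‖ = RCFPI.mNorm M x) :
    IsCocoercive θ⁻¹ fun z => e (e.symm z - T (e.symm z)) := by
  obtain ⟨C, hC, hTC⟩ := hT
  intro x y
  have h := hC (e.symm x) (e.symm y)
  rw [← he, ← he, map_sub, map_sub, e.apply_symm_apply, e.apply_symm_apply] at h
  have hd : ∀ z, e (e.symm z - T (e.symm z)) = θ • (z - e (C (e.symm z))) := fun z => by
    have : e.symm z - T (e.symm z) = θ • (e.symm z - C (e.symm z)) := by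
      rw [hTC, sub_smul, one_smul, smul_sub]
      abel
    rw [this, map_smul, map_sub, e.apply_symm_apply]
  simp only [hd]
  rw [← smul_sub]
  set p := e (C (e.symm x))
  set q := e (C (e.symm y))
  have e1 : x - p - (y - q) = (x - y) - (p - q) := by abel
  rw [e1, norm_smul, inner_smul_right, mul_pow, Real.norm_eq_abs, sq_abs, norm_sub_sq_real,
    inner_sub_right (x - y) (x - y) (p - q), real_inner_self_eq_norm_sq]
  have h2 : ‖p - q‖ ^ 2 ≤ ‖x - y‖ ^ 2 := by gcongr
  have e2 : ∀ r : ℝ, θ⁻¹ * (θ ^ 2 * r) = θ * r := fun r => by field_simp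
  rw [e2]
  nlinarith [mul_le_mul_of_nonneg_left h2 hθ.le]

theorem RCFPI.isInfimalDisplacement_iff (he : ∀ x, ‖e x‖ = RCFPI.mNorm M x) (v : H) :
    RCFPI.IsInfimalDisplacement M T v ↔
      e v ∈ closure (Set.range fun z => e (e.symm z - T (e.symm z))) ∧
        ∀ y ∈ closure (Set.range fun z => e (e.symm z - T (e.symm z))), ‖e v‖ ≤ ‖y‖ := by
  have hr : closure (Set.range fun z => e (e.symm z - T (e.symm z)))
      = e '' closure (Set.range fun x => x - T x) := by
    have h1 : Set.range (fun z => e (e.symm z - T (e.symm z)))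
        = e '' Set.range fun x => x - T x := by
      rw [← Set.range_comp]
      exact e.symm.surjective.range_comp fun x => e (x - T x)
    rw [h1]
    exact (e.toHomeomorph.image_closure _).symm
  rw [hr, RCFPI.IsInfimalDisplacement, e.injective.mem_set_image, Set.forall_mem_image]
  simp only [he]

/-- Existence and uniqueness of the infimal displacement vector. -/
theorem RCFPI.IsAveraged.existsUnique_isInfimalDisplacement [CompleteSpace H]
    (hM : RCFPI.IsPosDef M) (hT : RCFPI.IsAveraged M θ T) (hθ : 0 < θ) :
    ∃! v, RCFPI.IsInfimalDisplacement M T v := by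
  obtain ⟨G, _, _, e, he⟩ := hM.exists_equiv_norm_eq_mNorm
  have : CompleteSpace G := (completeSpace_congr (e := e.toEquiv) e.isUniformEmbedding).1 ‹_›
  have hA := hT.isCocoercive hθ he
  have hu := existsUnique_forall_norm_le (hA.convex_closure_range (inv_pos.2 hθ))
    isClosed_closure.isComplete (Set.range_nonempty _).closure
  exact (existsUnique_congr fun v => RCFPI.isInfimalDisplacement_iff he v).2
    (e.bijective.existsUnique_iff.1 hu)

end MNorm

/-! ### Block selection -/

section Blocks

variable {m : ℕ} {E : Fin m → Type*} [∀ i, NormedAddCommGroup (E i)]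
  [∀ i, InnerProductSpace ℝ (E i)]

/-- The projection of a direct sum onto its `i`th block, as an operator on the direct sum. -/
noncomputable def blockProj (i : Fin m) : PiLp 2 E →L[ℝ] PiLp 2 E :=
  ((PiLp.continuousLinearEquiv 2 ℝ E).symm : (∀ i, E i) →L[ℝ] PiLp 2 E) ∘L
    ContinuousLinearMap.single ℝ E i ∘L PiLp.proj 2 E i

theorem blockProj_apply (i j : Fin m) (u : PiLp 2 E) :
    blockProj i u j = (Pi.single i (u i) : ∀ i, E i) j := rfl

theorem sum_smul_blockProj (s : Fin m → ℝ) (u : PiLp 2 E) :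
    ∑ i, s i • blockProj i u = RCFPI.blockSelect s u := by
  ext j
  rw [WithLp.ofLp_sum, Finset.sum_apply, Finset.sum_eq_single j]
  · simp [blockProj_apply, RCFPI.blockSelect]
  · intro i _ hij
    simp [blockProj_apply, Pi.single_eq_of_ne hij.symm]
  · simp

theorem sum_blockProj (u : PiLp 2 E) : ∑ i, blockProj i u = u := by
  have h := sum_smul_blockProj (fun _ => 1) u
  simp only [one_smul] at h
  rw [h]
  ext j
  simp [RCFPI.blockSelect]

theorem blockSelect_smul (s : Fin m → ℝ) (c : ℝ) (u : PiLp 2 E) :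
    RCFPI.blockSelect s (c • u) = c • RCFPI.blockSelect s u := by
  ext j
  simp [RCFPI.blockSelect, smul_comm c]

variable {G : Type*} [NormedAddCommGroup G] [InnerProductSpace ℝ G] (e : PiLp 2 E ≃L[ℝ] G)

/-- The projection onto the `i`th block, transported along `e`. -/
noncomputable def conjBlockProj (i : Fin m) : G →L[ℝ] G :=
  (e : PiLp 2 E →L[ℝ] G) ∘L blockProj i ∘L (e.symm : G →L[ℝ] PiLp 2 E)

theorem mixture_conjBlockProj (s : Fin m → ℝ) (u : G) :
    mixture (conjBlockProj e) s u = e (RCFPI.blockSelect s (e.symm u)) := by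
  rw [← sum_smul_blockProj, map_sum]
  exact Finset.sum_congr rfl fun i _ => (map_smul e _ _).symm

theorem sum_conjBlockProj (u : G) : ∑ i, conjBlockProj e i u = u := by
  conv_rhs => rw [← e.apply_symm_apply u, ← sum_blockProj (e.symm u), map_sum]
  rfl

theorem mixtureIter_conjBlockProj (T : PiLp 2 E → PiLp 2 E) {θ : ℝ} (hθ : θ ≠ 0)
    (x0 : PiLp 2 E) (s : ℕ → Fin m → ℝ) (n : ℕ) :
    mixtureIter (conjBlockProj e) (fun z => e (e.symm z - T (e.symm z))) (e x0) s n
      = e (RCFPI.rcIter T θ x0 s n) := by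
  induction n with
  | zero => rfl
  | succ n ih =>
    rw [mixtureIter, ih, mixture_conjBlockProj]
    simp only [e.symm_apply_apply]
    rw [← map_sub, RCFPI.rcIter, RCFPI.rcStep, RCFPI.residual, blockSelect_smul,
      smul_inv_smul₀ hθ]

/-- Block selection by a vector in `[0, 1] ^ m` has second moment at most `α` in the norm of the
space, because `t ^ 2 ≤ t` on `[0, 1]` and distinct blocks are orthogonal. -/
theorem secondMomentBound_id {ν : Measure (Fin m → ℝ)} [IsProbabilityMeasure ν] {α : ℝ}
    (hν : RCFPI.IsSelectionLaw ν α) :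
    RCFPI.SecondMomentBound ν (ContinuousLinearMap.id ℝ (PiLp 2 E)) α := by
  intro u
  simp only [RCFPI.mNorm_id]
  have hle : ∫ s, ‖RCFPI.blockSelect s u‖ ^ 2 ∂ν ≤ ∫ s, ∑ i, s i * ‖u i‖ ^ 2 ∂ν := by
    refine integral_mono_of_nonneg (Eventually.of_forall fun s => sq_nonneg _)
      (integrable_finsetSum _ fun i _ => (integrable_coord hν i).mul_const _) ?_
    filter_upwards [hν.mem_Icc] with s hs
    rw [PiLp.norm_sq_eq_of_L2]
    refine Finset.sum_le_sum fun i _ => ?_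
    change ‖s i • u i‖ ^ 2 ≤ _
    rw [norm_smul, mul_pow, Real.norm_eq_abs, sq_abs]
    gcongr
    nlinarith [(hs i).1, (hs i).2]
  refine hle.trans_eq ?_
  rw [integral_finsetSum _ fun i _ => (integrable_coord hν i).mul_const _]
  simp only [integral_mul_const, hν.mean]
  rw [← Finset.mul_sum, PiLp.norm_sq_eq_of_L2]

end Blocks

theorem isPosDef_id {H : Type*} [NormedAddCommGroup H] [InnerProductSpace ℝ H] :
    RCFPI.IsPosDef (ContinuousLinearMap.id ℝ H) :=
  ⟨fun _ _ => rfl, 1, one_pos, fun x => by simp⟩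

/-! ### Almost sure convergence -/

section Convergence

/-- The σ-algebras generated by the variables before time `n`. -/
def pastFiltration {Ω 𝕊 : Type*} {mΩ : MeasurableSpace Ω} [m𝕊 : MeasurableSpace 𝕊]
    (Y : ℕ → Ω → 𝕊) (hY : ∀ n, Measurable (Y n)) : Filtration ℕ mΩ where
  seq n := ⨆ j ∈ Set.Iio n, m𝕊.comap (Y j)
  mono' _ _ hij := biSup_mono fun _ hk => lt_of_lt_of_le hk hij
  le' _ := iSup₂_le fun j _ => (hY j).comap_le

variable {m : ℕ} {E : Fin m → Type*} [∀ i, NormedAddCommGroup (E i)]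
  [∀ i, InnerProductSpace ℝ (E i)] [∀ i, CompleteSpace (E i)]
  {Ω : Type*} [MeasurableSpace Ω] {P : Measure Ω} [IsProbabilityMeasure P]
  {ν : Measure (Fin m → ℝ)} {α β θ : ℝ} {I : ℕ → Ω → Fin m → ℝ} {T : PiLp 2 E → PiLp 2 E}
  {M : PiLp 2 E →L[ℝ] PiLp 2 E}

theorem ae_tendsto_inv_smul_rcIter (hα0 : 0 < α) (hα1 : α ≤ 1) (hν : RCFPI.IsSelectionLaw ν α)
    (hI : ∀ k, HasLaw (I k) ν P) (hInd : iIndepFun I P) (hθ0 : 0 < θ) (hθ1 : θ ≤ 1)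
    (hM : RCFPI.IsPosDef M) (hT : RCFPI.IsAveraged M θ T)
    (hsq : RCFPI.SecondMomentBound ν M β) (hβ : β < α / θ) {v : PiLp 2 E}
    (hv : RCFPI.IsInfimalDisplacement M T v) (x0 : PiLp 2 E) :
    ∀ᵐ ω ∂P, Tendsto (fun k : ℕ => (k : ℝ)⁻¹ • RCFPI.rcIter T θ x0 (fun j => I j ω) k)
      atTop (𝓝 (-(α • v))) := by
  obtain ⟨G, _, _, e, he⟩ := hM.exists_equiv_norm_eq_mNorm
  have : CompleteSpace G :=
    (completeSpace_congr (e := e.toEquiv) e.isUniformEmbedding).1 inferInstance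
  obtain ⟨hv1, hv2⟩ := (RCFPI.isInfimalDisplacement_iff he v).1 hv
  -- measurable versions of the selection variables
  set J : ℕ → Ω → Fin m → ℝ := fun k => (hI k).aemeasurable.mk
  have hJm : ∀ k, Measurable (J k) := fun k => (hI k).aemeasurable.measurable_mk
  have hIJ : ∀ k, I k =ᵐ[P] J k := fun k => (hI k).aemeasurable.ae_eq_mk
  have hJlaw : ∀ k, HasLaw (J k) ν P := fun k => (hI k).congr (hIJ k).symm
  have hJind : iIndepFun J P := hInd.congr hIJ
  have hind : ∀ n, Indep (pastFiltration J hJm n)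
      (MeasurableSpace.comap (J n) inferInstance) P := fun n => by
    have h := indep_iSup_of_disjoint (S := Set.Iio n) (T := {n}) (fun k => (hJm k).comap_le)
      hJind (by simp)
    rwa [iSup_singleton] at h
  have hmeas : ∀ n, Measurable[pastFiltration J hJm (n + 1)] (J n) := fun n =>
    measurable_iff_comap_le.2 <| le_iSup₂_of_le (f := fun j (_ : j ∈ Set.Iio (n + 1)) =>
      MeasurableSpace.comap (J j) inferInstance) n (Nat.lt_succ_self n) le_rfl
  have hsq' : ∀ u, ∫ s, ‖mixture (conjBlockProj e) s u‖ ^ 2 ∂ν ≤ β * ‖u‖ ^ 2 := fun u => by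
    have h := hsq (e.symm u)
    rw [← he, e.apply_symm_apply] at h
    simpa only [mixture_conjBlockProj, he] using h
  have hmain := ae_tendsto_inv_smul_mixtureIter hν hα0 (inv_pos.2 hθ0)
    (hα1.trans ((one_le_inv₀ hθ0).2 hθ1)) (sum_conjBlockProj e) (hT.isCocoercive hθ0 he) hsq'
    (by rwa [← div_eq_mul_inv]) hJlaw hmeas hind hv1 hv2 (e x0)
  filter_upwards [hmain, ae_all_iff.2 hIJ] with ω hω hωJ
  simp only [hωJ]
  have h := (e.symm.continuous.tendsto _).comp hω
  rw [map_neg, map_smul, e.symm_apply_apply] at h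
  refine h.congr fun k => ?_
  rw [Function.comp_apply, mixtureIter_conjBlockProj e T hθ0.ne', map_smul, e.symm_apply_apply]

end Convergence

theorem mainTheorem2 {m : ℕ} {E : Fin m → Type*} [∀ i, NormedAddCommGroup (E i)]
    [∀ i, InnerProductSpace ℝ (E i)] [∀ i, CompleteSpace (E i)]
    {Ω : Type*} [MeasurableSpace Ω] (P : Measure Ω) [IsProbabilityMeasure P]
    (ν : Measure (Fin m → ℝ)) [IsProbabilityMeasure ν]
    (α : ℝ) (hα0 : 0 < α) (hα1 : α ≤ 1) (hν : RCFPI.IsSelectionLaw ν α)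
    (I : ℕ → Ω → Fin m → ℝ) (hI : ∀ k, HasLaw (I k) ν P) (hInd : iIndepFun I P)
    (T : PiLp 2 E → PiLp 2 E) (θ : ℝ) (hθ0 : 0 < θ) (x0 : PiLp 2 E) :
    -- the case of the norm of the space, with `θ ∈ (0, 1)`
    (θ < 1 → RCFPI.IsAveraged (ContinuousLinearMap.id ℝ (PiLp 2 E)) θ T →
      (∃! v, RCFPI.IsInfimalDisplacement (ContinuousLinearMap.id ℝ (PiLp 2 E)) T v) ∧
      ∀ v, RCFPI.IsInfimalDisplacement (ContinuousLinearMap.id ℝ (PiLp 2 E)) T v →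
        ∀ᵐ ω ∂P, Tendsto
          (fun k : ℕ => (k : ℝ)⁻¹ • RCFPI.rcIter T θ x0 (fun j => I j ω) k)
          atTop (𝓝 (-(α • v)))) ∧
    -- the case of a general `M`-norm, with `θ ∈ (0, 1]`
    (θ ≤ 1 → ∀ M : PiLp 2 E →L[ℝ] PiLp 2 E, RCFPI.IsPosDef M → RCFPI.IsAveraged M θ T →
      ∀ β : ℝ, RCFPI.SecondMomentBound ν M β → β < α / θ →
      (∃! v, RCFPI.IsInfimalDisplacement M T v) ∧
      ∀ v, RCFPI.IsInfimalDisplacement M T v →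
        ∀ᵐ ω ∂P, Tendsto
          (fun k : ℕ => (k : ℝ)⁻¹ • RCFPI.rcIter T θ x0 (fun j => I j ω) k)
          atTop (𝓝 (-(α • v)))) := by
  constructor
  · intro hθ1 hT
    refine ⟨hT.existsUnique_isInfimalDisplacement isPosDef_id hθ0, fun v hv => ?_⟩
    refine ae_tendsto_inv_smul_rcIter hα0 hα1 hν hI hInd hθ0 hθ1.le isPosDef_id hT
      (secondMomentBound_id hν) ?_ hv x0
    rw [lt_div_iff₀ hθ0]
    exact mul_lt_of_lt_one_right hα0 hθ1
  · intro hθ1 M hM hT β hsq hβ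
    exact ⟨hT.existsUnique_isInfimalDisplacement hM hθ0, fun v hv =>
      ae_tendsto_inv_smul_rcIter hα0 hα1 hν hI hInd hθ0 hθ1 hM hT hsq hβ hv x0⟩
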